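/- For a nonnegative integer $n$ let $Q_n$ be the hypercube of dimension $n$, i.e. the graph whose vertices are the binary sequences of length $n$ and whose edges are the pairs of sequences that differ in exactly one position. For graphs $G,T$ let $N(G,T)$ be the number of (not necessarily induced) subgraphs of $G$ that are isomorphic to $T$; let $\mathrm{ex}(G,T,H)$ be the maximum of $N(G',T)$ over all subgraphs $G'$ of $G$ that contain no subgraph isomorphic to $H$; and let $\mathbf d(G,T,H)=\mathrm{ex}(G,T,H)/N(G,T)$. There is an absolute constant $\alpha>0$ such that for all integers $k$ and $\ell$ with $2\le \ell<k$ and all sufficiently large integers $n$ (how large may depend on $k$ and $\ell$), \[ \max\left\{1-\frac{\ell}{k},\; 1-\frac{4\binom{\ell+2}{3}}{k(k+2)}\right\}\;\le\;\mathbf d(Q_n,Q_\ell,Q_k)\;\le\;\min\left\{1-\frac{\ell\,2^{\ell}}{k\,2^{k}},\; 1-\alpha\,\frac{\log k}{k\,2^{k}}\right\}, \] where $\log$ is the natural logarithm. -/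

import Mathlib

/-- The hypercube `Q_n`: its vertices are the binary sequences of length `n`, and two of them are
adjacent when they differ in exactly one position. -/
def hypercube (n : ℕ) : SimpleGraph (Fin n → Bool) where
  Adj x y := hammingDist x y = 1
  symm := ⟨fun x y h => by rw [hammingDist_comm]; exact h⟩
  loopless := ⟨fun x h => by simp at h⟩

open Classical in
/-- The generalized extremal number `ex(G, T, H)`: the maximum, over all subgraphs `G'` of the
finite graph `G` that contain no subgraph isomorphic to `H`, of the number of subgraphs of `G'`
that are isomorphic to `T`. -/
noncomputable def genExtremal {V W U : Type*} [Fintype V]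
    (G : SimpleGraph V) (T : SimpleGraph W) (H : SimpleGraph U) : ℕ :=
  (Finset.univ.filter (fun G' : G.Subgraph => H.Free G'.coe)).sup
    (fun G' => G'.coe.copyCount T)

/-- The generalized Turán density `d(G, T, H) = ex(G, T, H) / N(G, T)`, where `N(G, T)` is the
number of subgraphs of `G` that are isomorphic to `T`. -/
noncomputable def genTuranDensity {V W U : Type*} [Fintype V]
    (G : SimpleGraph V) (T : SimpleGraph W) (H : SimpleGraph U) : ℝ :=
  (genExtremal G T H : ℝ) / (G.copyCount T : ℝ)

/-! An injective homomorphism of cubes maps opposite edges of a 4-cycle to parallel edges, so the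
copies of `Q_l` in `Q_n` are exactly its `l`-faces (`exists_eq_cubeMap`, `nonempty_iso_iff`). For
positive `l`, such a face survives in a subgraph iff it contains no missing edge. The theorem is
therefore about sets `E` of edges that meet every `k`-face: the density is one minus the least
possible proportion of `l`-faces met by `E` (`le_genTuranDensity`, `genTuranDensity_le`).

For the lower bounds, colour the edges so that every `k`-face shows all colours while every `l`-face
shows only few. Each colour class is an admissible `E`, and by averaging some class meets few
`l`-faces (`exists_color_card_hit_le`). Levels modulo `k` give `k` colours, at most `l` of them on
an `l`-face. Counting ones separately on the two sides of the free coordinate, modulo `a` and `b`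
with `a + b = k + 1`, gives `a * b` colours, at most `(l + 2).choose 3` of them on an `l`-face.

For the upper bounds, average over faces. An edge of `E` in a `k`-face spoils `(k - 1).choose (l -
1)` of its `l`-faces, which gives the first bound. For the logarithmic one, the edges of `E` inside
a `(k + 2)`-face must separate its free coordinates, so there are at least `log₃ (k + 2)` of them
(`le_three_pow_of_hit`); the density of `E` then passes to the `l`-faces it meets
(`card_mul_card_faces_le_card_hit`). -/

/-! ### Patterns: faces of the cube -/

/-- A face of the cube: `none` marks a free coordinate, `some b` a coordinate fixed to `b`. -/
abbrev Pattern (n : ℕ) := Fin n → Option Bool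

namespace Pattern

open Finset

variable {n : ℕ}

/-- The free coordinates of a face. -/
def stars (p : Pattern n) : Finset (Fin n) := {i | p i = none}

/-- The coordinates of a face that are fixed to `true`. -/
def ones (p : Pattern n) : Finset (Fin n) := {i | p i = some true}

/-- The face `q` is contained in the face `p`. -/
abbrev Within (q p : Pattern n) : Prop := ∀ i, p i = none ∨ q i = p i

/-- The faces of dimension `m`. -/
def faces (n m : ℕ) : Finset (Pattern n) := {p | #(stars p) = m}

@[simp] lemma mem_stars {p : Pattern n} {i : Fin n} : i ∈ stars p ↔ p i = none := by simp [stars]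

@[simp] lemma mem_ones {p : Pattern n} {i : Fin n} : i ∈ ones p ↔ p i = some true := by simp [ones]

@[simp] lemma mem_faces {m : ℕ} {p : Pattern n} : p ∈ faces n m ↔ #(stars p) = m := by simp [faces]

lemma Within.trans {p q r : Pattern n} (h : Within p q) (h' : Within q r) : Within p r := by
  intro i
  rcases h' i with h1 | h1
  · exact Or.inl h1
  · rcases h i with h2 | h2
    · exact Or.inl (h1 ▸ h2)
    · exact Or.inr (h2.trans h1)

lemma Within.stars_subset {q p : Pattern n} (h : Within q p) : stars q ⊆ stars p := by
  intro i hi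
  rw [mem_stars] at hi ⊢
  rcases h i with h | h
  · exact h
  · rw [← h, hi]

lemma within_free (q : Pattern n) : Within q (fun _ => none) := fun _ => Or.inl rfl

lemma stars_free : stars (fun _ => none : Pattern n) = univ := by ext; simp

/-- The number of faces of dimension `b` between two given faces. -/
lemma card_between {q p : Pattern n} (h : Within q p) {b : ℕ} (hb : #(stars q) ≤ b) :
    #{r ∈ faces n b | Within q r ∧ Within r p}
      = (#(stars p) - #(stars q)).choose (b - #(stars q)) := by
  rw [← card_sdiff_of_subset h.stars_subset, ← card_powersetCard]
  refine card_nbij' (fun r => stars r \ stars q) (fun T i => if i ∈ T then none else q i)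
    ?_ ?_ ?_ ?_
  · intro r hr
    simp only [coe_filter, Set.mem_ofPred_eq, mem_faces] at hr
    obtain ⟨hr, h1, h2⟩ := hr
    simp only [mem_powersetCard, mem_coe]
    refine ⟨sdiff_subset_sdiff h2.stars_subset le_rfl, ?_⟩
    rw [card_sdiff_of_subset h1.stars_subset, hr]
  · intro T hT
    simp only [mem_powersetCard, mem_coe] at hT
    obtain ⟨hT, hc⟩ := hT
    simp only [coe_filter, Set.mem_ofPred_eq, mem_faces]
    have hs : stars (fun i => if i ∈ T then none else q i) = T ∪ stars q := by
      ext i; by_cases hi : i ∈ T <;> simp [hi]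
    refine ⟨?_, ?_, ?_⟩
    · rw [hs, card_union_of_disjoint, hc]
      · omega
      · exact disjoint_of_subset_left hT sdiff_disjoint
    · intro i
      by_cases hi : i ∈ T <;> simp [hi]
    · intro i
      by_cases hi : i ∈ T
      · have := hT hi
        simp only [mem_sdiff, mem_stars] at this
        exact Or.inl this.1
      · simpa [hi] using h i
  · intro r hr
    simp only [coe_filter, Set.mem_ofPred_eq, mem_faces] at hr
    obtain ⟨hr, h1, h2⟩ := hr
    funext i
    rcases h1 i with h3 | h3
    · simp only [mem_sdiff, mem_stars, h3]
      by_cases h4 : q i = none <;> simp [h4]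
    · simp only [mem_sdiff, mem_stars, h3]
      by_cases h4 : r i = none <;> simp [h4]
  · intro T hT
    simp only [mem_powersetCard, mem_coe] at hT
    obtain ⟨hT, hc⟩ := hT
    ext i
    by_cases hi : i ∈ T
    · have := hT hi
      simp only [mem_sdiff, mem_stars] at this
      simp [hi, this.2]
    · simp [hi]

lemma card_above (q : Pattern n) {b : ℕ} (hb : #(stars q) ≤ b) :
    #{r ∈ faces n b | Within q r} = (n - #(stars q)).choose (b - #(stars q)) := by
  have := card_between (within_free q) hb
  rw [stars_free, card_univ, Fintype.card_fin] at this
  rw [← this]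
  exact congrArg card (filter_congr fun r _ => (and_iff_left (within_free r)).symm)

lemma card_below (p : Pattern n) (a : ℕ) :
    #{q ∈ faces n a | Within q p} = (#(stars p)).choose a * 2 ^ (#(stars p) - a) := by
  have hmaps : ∀ q ∈ ({q ∈ faces n a | Within q p} : Finset _),
      stars q ∈ powersetCard a (stars p) := by
    intro q hq
    simp only [mem_filter, mem_faces] at hq
    exact mem_powersetCard.2 ⟨hq.2.stars_subset, hq.1⟩
  rw [card_eq_sum_card_fiberwise hmaps, ← card_powersetCard, ← smul_eq_mul]
  refine sum_const_nat (fun T hT => ?_)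
  obtain ⟨hT, hc⟩ := mem_powersetCard.1 hT
  -- Once the free set `T` is chosen, each remaining free coordinate of `p` takes either bit
  -- independently, so the fibre is a product.
  have hfiber : ({q ∈ ({q ∈ faces n a | Within q p} : Finset _) | stars q = T} : Finset _)
      = Fintype.piFinset (fun i => if i ∈ T then {none}
          else if i ∈ stars p then {some true, some false} else {p i}) := by
    ext q
    simp only [mem_filter, mem_faces, Fintype.mem_piFinset]
    constructor
    · rintro ⟨⟨-, hw⟩, rfl⟩ i
      by_cases hi : q i = none
      · simp [hi]
      · rcases hw i with h | h
        · rcases h' : q i with _ | b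
          · exact absurd h' hi
          · cases b <;> simp [h, h']
        · rw [h] at hi
          simp [h, hi]
    · intro hq
      have hst : stars q = T := by
        ext i
        have := hq i
        by_cases hi : i ∈ T
        · simpa [hi] using this
        · by_cases hp : p i = none
          · simp only [hi, hp, mem_stars, if_true, if_false, mem_insert, mem_singleton] at this
            rcases this with h | h <;> simp [h, hi]
          · simp only [hi, hp, mem_stars, if_false, mem_singleton] at this
            simp [this, hi, hp]
      refine ⟨⟨by rw [hst, hc], fun i => ?_⟩, hst⟩
      have := hq i
      by_cases hi : i ∈ T
      · exact Or.inl (mem_stars.1 (hT hi))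
      · by_cases hp : p i = none
        · exact Or.inl hp
        · simp only [hi, hp, mem_stars, if_false, mem_singleton] at this
          exact Or.inr this
  have hcard : ∀ i, #(if i ∈ T then ({none} : Finset (Option Bool))
      else if i ∈ stars p then {some true, some false} else {p i})
      = if i ∈ stars p \ T then 2 else 1 := by
    intro i
    by_cases hi : i ∈ T
    · simp [hi]
    · by_cases hp : p i = none <;> simp [hi, hp]
  rw [hfiber, Fintype.card_piFinset, prod_congr rfl (fun i _ => hcard i), prod_ite_mem,
    univ_inter, prod_const, card_sdiff_of_subset hT, hc]

lemma card_faces (n m : ℕ) : #(faces n m) = n.choose m * 2 ^ (n - m) := by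
  have := card_below (fun _ => none : Pattern n) m
  rw [stars_free, card_univ, Fintype.card_fin] at this
  rw [← this]
  exact congrArg card (filter_true_of_mem fun r _ => within_free r).symm

/-! ### Double counting between faces of different dimensions -/

/-- If every `m`-face contains at least `t` members of a family `A` of `l`-faces, then the density
of `A` is at least `t` divided by the number of `l`-faces of an `m`-face. -/
lemma mul_card_faces_le {l m t : ℕ} (hlm : l ≤ m) (hmn : m ≤ n) {A : Finset (Pattern n)}
    (hA : A ⊆ faces n l) (h : ∀ M ∈ faces n m, t ≤ #{a ∈ A | Within a M}) :
    t * #(faces n l) ≤ #A * (m.choose l * 2 ^ (m - l)) := by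
  have key : #(faces n m) * t ≤ #A * (n - l).choose (m - l) := by
    refine card_mul_le_card_mul (fun M a => Within a M) h (fun a ha => ?_)
    have hl : #(stars a) = l := mem_faces.1 (hA ha)
    have := card_above a (b := m) (by omega)
    rw [hl] at this
    exact this.le
  rw [card_faces] at key ⊢
  have hc : 0 < (n - l).choose (m - l) := Nat.choose_pos (by omega)
  refine Nat.le_of_mul_le_mul_right ?_ hc
  have h2 : 2 ^ (n - l) = 2 ^ (n - m) * 2 ^ (m - l) := by rw [← pow_add]; congr 1; omega
  have h3 := Nat.choose_mul (n := n) hlm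
  calc t * (n.choose l * 2 ^ (n - l)) * (n - l).choose (m - l)
      = t * (n.choose l * (n - l).choose (m - l)) * 2 ^ (n - l) := by ring
    _ = (n.choose m * 2 ^ (n - m) * t) * (m.choose l * 2 ^ (m - l)) := by rw [← h3, h2]; ring
    _ ≤ (#A * (n - l).choose (m - l)) * (m.choose l * 2 ^ (m - l)) := by gcongr
    _ = _ := by ring

/-- The `l`-faces that contain a member of `E`. -/
def hit (E : Finset (Pattern n)) (l : ℕ) : Finset (Pattern n) :=
  {L ∈ faces n l | ∃ e ∈ E, Within e L}

lemma hit_subset (E : Finset (Pattern n)) (l : ℕ) : hit E l ⊆ faces n l := filter_subset _ _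

/-- Passing from edges to the `l`-faces above them does not decrease density: the containment
relation is biregular, and all `l`-faces above a member of `E` are hit. -/
lemma card_mul_card_faces_le_card_hit {l : ℕ} (hl : 1 ≤ l) (hln : l ≤ n)
    {E : Finset (Pattern n)} (hE : E ⊆ faces n 1) :
    #E * #(faces n l) ≤ #(hit E l) * #(faces n 1) := by
  have key : #E * (n - 1).choose (l - 1) ≤ #(hit E l) * (l * 2 ^ (l - 1)) := by
    refine card_mul_le_card_mul (fun e L => Within e L) (fun e he => ?_) (fun L hL => ?_)
    · have he1 : #(stars e) = 1 := mem_faces.1 (hE he)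
      have := card_above e (b := l) (by omega)
      rw [he1] at this
      rw [← this]
      refine card_le_card fun L hL => ?_
      obtain ⟨hL, hw⟩ := mem_filter.1 hL
      exact mem_filter.2 ⟨mem_filter.2 ⟨hL, e, he, hw⟩, hw⟩
    · have hL1 : #(stars L) = l := mem_faces.1 (hit_subset E l hL)
      have := card_below L 1
      rw [hL1, Nat.choose_one_right] at this
      rw [← this]
      exact card_le_card (filter_subset_filter _ hE)
  have hid : #(faces n l) * (l * 2 ^ (l - 1)) = #(faces n 1) * (n - 1).choose (l - 1) := by
    have h3 := Nat.choose_mul (n := n) hl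
    have h2 : 2 ^ (n - 1) = 2 ^ (n - l) * 2 ^ (l - 1) := by rw [← pow_add]; congr 1; omega
    rw [Nat.choose_one_right] at h3
    rw [card_faces, card_faces, h2]
    calc _ = (n.choose l * l) * (2 ^ (n - l) * 2 ^ (l - 1)) := by ring
      _ = _ := by rw [h3]; ring
  refine Nat.le_of_mul_le_mul_right (c := l * 2 ^ (l - 1)) ?_ (by positivity)
  calc _ = #E * (#(faces n l) * (l * 2 ^ (l - 1))) := by ring
    _ = (#E * (n - 1).choose (l - 1)) * #(faces n 1) := by rw [hid]; ring
    _ ≤ (#(hit E l) * (l * 2 ^ (l - 1))) * #(faces n 1) := by gcongr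
    _ = _ := by ring

/-- All `l`-faces between an edge of `E` and a `k`-face containing it are hit; averaging this local
count over the `k`-faces gives the global one. -/
lemma choose_mul_card_faces_le_card_hit {k l : ℕ} (hl : 1 ≤ l) (hlk : l ≤ k) (hkn : k ≤ n)
    {E : Finset (Pattern n)} (hE : E ⊆ faces n 1) (h : faces n k ⊆ hit E k) :
    (k - 1).choose (l - 1) * #(faces n l) ≤ #(hit E l) * (k.choose l * 2 ^ (k - l)) := by
  refine mul_card_faces_le hlk hkn (hit_subset E l) (fun K hK => ?_)
  obtain ⟨-, e, he, hw⟩ := mem_filter.1 (h hK)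
  have he1 : #(stars e) = 1 := mem_faces.1 (hE he)
  have := card_between hw (b := l) (by omega)
  rw [he1, mem_faces.1 hK] at this
  rw [← this]
  refine card_le_card fun L hL => ?_
  obtain ⟨hL, hw1, hw2⟩ := mem_filter.1 hL
  exact mem_filter.2 ⟨mem_filter.2 ⟨hL, e, he, hw1⟩, hw2⟩

/-- A family of edges that meets every `k`-face has logarithmically many members in every
`(k+2)`-face: its members separate the free coordinates. -/
lemma le_three_pow_of_hit {k : ℕ} {E : Finset (Pattern n)} (h : faces n k ⊆ hit E k)
    {M : Pattern n} (hM : M ∈ faces n (k + 2)) :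
    k + 2 ≤ 3 ^ #{e ∈ E | Within e M} := by
  have hinj : Function.Injective
      (fun (i : stars M) (e : ({e ∈ E | Within e M} : Finset _)) => e.1 i.1) := by
    rintro ⟨i, hi⟩ ⟨j, hj⟩ hij
    by_contra hne
    have hne : i ≠ j := fun h => hne (Subtype.ext h)
    rw [mem_stars] at hi hj
    -- If no edge of `E` inside `M` distinguishes `i` from `j`, fix them to opposite bits: an edge
    -- of `E` in the resulting `k`-face does distinguish them. Each edge shows one of three symbols
    -- at a coordinate, hence the base 3.
    set K : Pattern n := Function.update (Function.update M i (some true)) j (some false) with hK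
    have hst : stars K = ((stars M).erase i).erase j := by
      ext x
      simp only [hK, mem_stars, mem_erase, Function.update_apply]
      by_cases h1 : x = j <;> by_cases h2 : x = i <;> simp [h1, h2, hne]
    have hKM : Within K M := by
      intro x
      by_cases h1 : x = j
      · exact Or.inl (h1 ▸ hj)
      · by_cases h2 : x = i
        · exact Or.inl (h2 ▸ hi)
        · exact Or.inr (by simp [hK, h1, h2])
    have hKf : K ∈ faces n k := by
      rw [mem_faces, hst, card_erase_of_mem, card_erase_of_mem, mem_faces.1 hM]
      · rfl
      · simpa using hi
      · simpa [hne.symm] using hj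
    obtain ⟨-, e, he, hw⟩ := mem_filter.1 (h hKf)
    have h1 := congrFun hij ⟨e, mem_filter.2 ⟨he, hw.trans hKM⟩⟩
    have h2 := hw i
    have h3 := hw j
    simp [hK, hne] at h1 h2 h3
    simp [h2, h3] at h1
  have := Fintype.card_le_of_injective _ hinj
  rw [Fintype.card_fun, Fintype.card_coe, Fintype.card_coe, mem_faces.1 hM] at this
  exact this

/-! ### Edge colourings and their colour classes -/

/-- If an edge colouring shows at most `t` colours on every `l`-face, then some colour class meets
at most a proportion `t / #C` of the `l`-faces. -/
lemma exists_color_card_hit_le {C : Type*} [Fintype C] [Nonempty C] [DecidableEq C]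
    (χ : Pattern n → C) {l t : ℕ}
    (h : ∀ L ∈ faces n l, #(image χ {e ∈ faces n 1 | Within e L}) ≤ t) :
    ∃ c, #(hit {e ∈ faces n 1 | χ e = c} l) * Fintype.card C ≤ t * #(faces n l) := by
  have key : ∑ c, #(hit {e ∈ faces n 1 | χ e = c} l) ≤ #(faces n l) * t := by
    have h1 := sum_card_bipartiteAbove_eq_sum_card_bipartiteBelow
      (s := (univ : Finset C)) (t := faces n l)
      (fun c L => ∃ e ∈ ({e ∈ faces n 1 | χ e = c} : Finset _), Within e L)
    refine (h1.le).trans (sum_le_card_nsmul _ _ _ fun L hL => (card_le_card ?_).trans (h L hL))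
    intro c hc
    obtain ⟨-, e, he, hw⟩ := mem_filter.1 hc
    obtain ⟨he, hχ⟩ := mem_filter.1 he
    exact mem_image.2 ⟨e, mem_filter.2 ⟨he, hw⟩, hχ⟩
  by_contra! hc
  have h2 := sum_lt_sum_of_nonempty (s := (univ : Finset C)) univ_nonempty (fun c _ => hc c)
  rw [sum_const, card_univ, smul_eq_mul, ← sum_mul] at h2
  refine h2.not_ge ((Nat.mul_le_mul_right (Fintype.card C) key).trans_eq ?_)
  ring

/-- The edge of the face `K` in direction `i` whose free coordinates other than `i` are `true`
exactly on `U`. -/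
def edgeOf (K : Pattern n) (i : Fin n) (U : Finset (Fin n)) : Pattern n :=
  fun j => if j = i then none else if K j = none then some (decide (j ∈ U)) else K j

lemma stars_edgeOf (K : Pattern n) (i : Fin n) (U : Finset (Fin n)) :
    stars (edgeOf K i U) = {i} := by
  ext j
  by_cases h : j = i <;> by_cases h' : K j = none <;> simp [edgeOf, h, h']

lemma edgeOf_within {K : Pattern n} {i : Fin n} (hi : i ∈ stars K) (U : Finset (Fin n)) :
    Within (edgeOf K i U) K := by
  intro j
  by_cases h : j = i
  · exact Or.inl (by simpa [h] using hi)
  · by_cases h' : K j = none <;> simp [edgeOf, h, h']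

lemma card_filter_ones_edgeOf {K : Pattern n} {i : Fin n} (hi : i ∈ stars K)
    {U : Finset (Fin n)} (hU : U ⊆ (stars K).erase i) (Q : Fin n → Prop) [DecidablePred Q] :
    #{j ∈ ones (edgeOf K i U) | Q j} = #{j ∈ ones K | Q j} + #{j ∈ U | Q j} := by
  rw [← card_union_of_disjoint, ← filter_union]
  · congr 2
    ext j
    have h1 : j ∈ U → j ≠ i ∧ K j = none := fun h => by simpa using hU h
    rw [mem_stars] at hi
    by_cases h : j = i
    · subst h
      have : j ∉ U := fun h => (h1 h).1 rfl
      simp [edgeOf, hi, this]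
    · by_cases h' : K j = none
      · simp [edgeOf, h, h']
      · have : j ∉ U := fun h => h' (h1 h).2
        simp [edgeOf, h, h', this]
  · rw [disjoint_left]
    intro j h2 h3
    have h2 := (mem_filter.1 h2).1
    have h3 := hU (mem_filter.1 h3).1
    simp only [mem_ones, mem_erase, mem_stars] at h2 h3
    rw [h2] at h3
    simp at h3

lemma exists_card_filter_ones_eq {e L : Pattern n} (h : Within e L) (Q : Fin n → Prop)
    [DecidablePred Q] :
    ∃ u ≤ #{j ∈ stars L \ stars e | Q j},
      #{j ∈ ones e | Q j} = #{j ∈ ones L | Q j} + u := by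
  have hsub : ones L ⊆ ones e := by
    intro j hj
    rw [mem_ones] at hj ⊢
    rcases h j with h | h
    · rw [h] at hj; cases hj
    · rw [h, hj]
  refine ⟨#{j ∈ ones e \ ones L | Q j}, card_le_card (filter_subset_filter _ ?_), ?_⟩
  · intro j hj
    simp only [mem_sdiff, mem_ones, mem_stars] at hj ⊢
    rcases h j with h | h
    · exact ⟨h, by simp [hj.1]⟩
    · exact absurd (h ▸ hj.1) hj.2
  · rw [← card_union_of_disjoint, ← filter_union, union_sdiff_of_subset hsub]
    exact disjoint_filter_filter disjoint_sdiff

/-- The colouring of the edges by their level modulo `k`. -/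
def levelColor (k : ℕ) (e : Pattern n) : ZMod k := (#(ones e) : ZMod k)

/-- In any direction of a `k`-face, the other `k - 1` free coordinates contribute any number of ones
from `0` to `k - 1`, which covers all residues. -/
lemma faces_subset_hit_levelColor {k : ℕ} [NeZero k] (c : ZMod k) :
    faces n k ⊆ hit {e ∈ faces n 1 | levelColor k e = c} k := by
  intro K hK
  have hk := mem_faces.1 hK
  obtain ⟨i, hi⟩ : (stars K).Nonempty := card_pos.1 (hk ▸ Nat.pos_of_ne_zero (NeZero.ne k))
  obtain ⟨U, hU, hc⟩ := exists_subset_card_eq (s := (stars K).erase i)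
    (n := (c - (#(ones K) : ZMod k)).val) (by
      rw [card_erase_of_mem hi, hk]
      have := ZMod.val_lt (c - (#(ones K) : ZMod k))
      omega)
  have h1 := card_filter_ones_edgeOf hi hU (fun _ => True)
  simp only [filter_true] at h1
  refine mem_filter.2 ⟨hK, edgeOf K i U, mem_filter.2 ⟨?_, ?_⟩, edgeOf_within hi U⟩
  · rw [mem_faces, stars_edgeOf, card_singleton]
  · rw [levelColor, h1, hc]
    simp

lemma card_image_levelColor_le (k : ℕ) {l : ℕ} {L : Pattern n} (hL : L ∈ faces n l) :
    #(image (levelColor k) {e ∈ faces n 1 | Within e L}) ≤ l := by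
  have : image (levelColor k) {e ∈ faces n 1 | Within e L}
      ⊆ (range l).image (fun u => ((#(ones L) + u : ℕ) : ZMod k)) := by
    intro c hc
    obtain ⟨e, he, rfl⟩ := mem_image.1 hc
    obtain ⟨he, hw⟩ := mem_filter.1 he
    obtain ⟨u, hu, h⟩ := exists_card_filter_ones_eq hw (fun _ => True)
    simp only [filter_true, card_sdiff_of_subset hw.stars_subset, mem_faces.1 he,
      mem_faces.1 hL] at hu h
    have := card_le_card hw.stars_subset
    rw [mem_faces.1 he, mem_faces.1 hL] at this
    exact mem_image.2 ⟨u, mem_range.2 (by omega), by rw [levelColor, h]⟩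
  exact (card_le_card this).trans (card_image_le.trans (card_range l).le)

/-- The colouring of the edges by the numbers of ones to the left and to the right of the free
coordinate, modulo `a` and `b`. -/
def sideColor (a b : ℕ) (e : Pattern n) : ZMod a × ZMod b :=
  (((#{j ∈ ones e | ∀ i ∈ stars e, j < i} : ℕ) : ZMod a),
    ((#{j ∈ ones e | ∀ i ∈ stars e, i < j} : ℕ) : ZMod b))

lemma image_rank {α : Type*} [LinearOrder α] (S : Finset α) :
    S.image (fun i => #{j ∈ S | j < i}) = range #S ∧
      Set.InjOn (fun i => #{j ∈ S | j < i}) S := by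
  have hinj : Set.InjOn (fun i => #{j ∈ S | j < i}) S := by
    refine StrictMonoOn.injOn fun i hi j hj hij => card_lt_card ?_
    refine ⟨fun x hx => ?_, fun h => ?_⟩
    · simp only [mem_filter] at hx ⊢
      exact ⟨hx.1, hx.2.trans hij⟩
    · have := h (mem_filter.2 ⟨hi, hij⟩)
      simp at this
  refine ⟨eq_of_subset_of_card_le ?_ ?_, hinj⟩
  · intro r hr
    obtain ⟨i, hi, rfl⟩ := mem_image.1 hr
    refine mem_range.2 (card_lt_card ⟨filter_subset _ _, fun h => ?_⟩)
    have := h hi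
    simp at this
  · rw [card_range, card_image_of_injOn hinj]

lemma card_lt_add_card_gt {α : Type*} [LinearOrder α] {S : Finset α} {i : α} (hi : i ∈ S) :
    #{j ∈ S | j < i} + #{j ∈ S | i < j} + 1 = #S := by
  have h1 := card_filter_add_card_filter_not (s := S.erase i) (fun j => j < i)
  rw [card_erase_of_mem hi] at h1
  have h2 : ({j ∈ S.erase i | j < i} : Finset α) = {j ∈ S | j < i} := by
    ext j
    simp only [mem_filter, mem_erase]
    exact ⟨fun h => ⟨h.1.2, h.2⟩, fun h => ⟨⟨h.2.ne, h.1⟩, h.2⟩⟩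
  have h3 : ({j ∈ S.erase i | ¬ j < i} : Finset α) = {j ∈ S | i < j} := by
    ext j
    simp only [mem_filter, mem_erase, not_lt]
    exact ⟨fun h => ⟨h.1.2, lt_of_le_of_ne h.2 (Ne.symm h.1.1)⟩,
      fun h => ⟨⟨h.2.ne', h.1⟩, h.2.le⟩⟩
  rw [h2, h3] at h1
  have := card_pos.2 ⟨i, hi⟩
  omega

/-- The free coordinate of rank `a - 1` has `a - 1` free coordinates on its left and `b - 1` on its
right, just enough to realise all residues modulo `a` and modulo `b` independently. -/
lemma faces_subset_hit_sideColor {a b k : ℕ} [NeZero a] [NeZero b] (hab : a + b = k + 1)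
    (c : ZMod a × ZMod b) :
    faces n k ⊆ hit {e ∈ faces n 1 | sideColor a b e = c} k := by
  intro K hK
  have hk := mem_faces.1 hK
  have ha := Nat.pos_of_ne_zero (NeZero.ne a)
  have hb := Nat.pos_of_ne_zero (NeZero.ne b)
  have hmem : a - 1 ∈ (stars K).image (fun i => #{j ∈ stars K | j < i}) := by
    rw [(image_rank _).1, hk, mem_range]; omega
  obtain ⟨i, hi, hr⟩ := mem_image.1 hmem
  have hg := card_lt_add_card_gt hi
  obtain ⟨U, hU, hUc⟩ := exists_subset_card_eq (s := {j ∈ stars K | j < i})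
    (n := (c.1 - ((#{j ∈ ones K | j < i} : ℕ) : ZMod a)).val) (by
      have := ZMod.val_lt (c.1 - ((#{j ∈ ones K | j < i} : ℕ) : ZMod a))
      omega)
  obtain ⟨V, hV, hVc⟩ := exists_subset_card_eq (s := {j ∈ stars K | i < j})
    (n := (c.2 - ((#{j ∈ ones K | i < j} : ℕ) : ZMod b)).val) (by
      have := ZMod.val_lt (c.2 - ((#{j ∈ ones K | i < j} : ℕ) : ZMod b))
      omega)
  have hU' : ∀ j ∈ U, j ∈ stars K ∧ j < i := fun j hj => mem_filter.1 (hU hj)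
  have hV' : ∀ j ∈ V, j ∈ stars K ∧ i < j := fun j hj => mem_filter.1 (hV hj)
  have hUV : U ∪ V ⊆ (stars K).erase i := by
    intro j hj
    rcases mem_union.1 hj with hj | hj
    · exact mem_erase.2 ⟨(hU' j hj).2.ne, (hU' j hj).1⟩
    · exact mem_erase.2 ⟨(hV' j hj).2.ne', (hV' j hj).1⟩
  have hl : ({j ∈ U ∪ V | j < i} : Finset _) = U := by
    ext j
    simp only [mem_filter, mem_union]
    exact ⟨fun h => h.1.resolve_right fun hj => (hV' j hj).2.not_gt h.2,
      fun h => ⟨Or.inl h, (hU' j h).2⟩⟩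
  have hr : ({j ∈ U ∪ V | i < j} : Finset _) = V := by
    ext j
    simp only [mem_filter, mem_union]
    exact ⟨fun h => h.1.resolve_left fun hj => (hU' j hj).2.not_gt h.2,
      fun h => ⟨Or.inr h, (hV' j h).2⟩⟩
  have h1 := card_filter_ones_edgeOf hi hUV (fun j => j < i)
  have h2 := card_filter_ones_edgeOf hi hUV (fun j => i < j)
  rw [hl, hUc] at h1
  rw [hr, hVc] at h2
  refine mem_filter.2 ⟨hK, edgeOf K i (U ∪ V), mem_filter.2 ⟨?_, ?_⟩, edgeOf_within hi _⟩
  · rw [mem_faces, stars_edgeOf, card_singleton]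
  · simp only [sideColor, stars_edgeOf, mem_singleton, forall_eq]
    rw [h1, h2]
    ext <;> simp

/-- This counts the triples in an `(l + 2)`-set by their middle element; the induction is Pascal's
rule. -/
lemma sum_succ_mul_sub (l : ℕ) : ∑ r ∈ range l, (r + 1) * (l - r) = (l + 2).choose 3 := by
  induction l with
  | zero => rfl
  | succ l ih =>
    have h : ∀ r ∈ range (l + 1), (r + 1) * (l + 1 - r) = (r + 1) * (l - r) + (r + 1) := by
      intro r hr
      have : l + 1 - r = (l - r) + 1 := by have := mem_range.1 hr; omega
      rw [this]; ring
    have hg : ∑ r ∈ range (l + 1), (r + 1) = (l + 2).choose 2 := by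
      rw [Nat.choose_two_right, ← sum_range_id, sum_range_succ' _ (l + 1), add_zero]
    rw [sum_congr rfl h, sum_add_distrib, sum_range_succ, ih, hg, Nat.sub_self, mul_zero, add_zero,
      show l + 1 + 2 = (l + 2) + 1 from rfl, Nat.choose_succ_succ' (l + 2) 2, add_comm]

/-- An edge in the direction of rank `r` has `r` free coordinates of `L` on its left and `l - 1 - r`
on its right, so that direction shows at most `(r + 1) * (l - r)` colours. -/
lemma card_image_sideColor_le (a b : ℕ) {l : ℕ} {L : Pattern n} (hL : L ∈ faces n l) :
    #(image (sideColor a b) {e ∈ faces n 1 | Within e L}) ≤ (l + 2).choose 3 := by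
  have hl := mem_faces.1 hL
  set f : Fin n → ℕ := fun i => #{j ∈ stars L | j < i}
  have hsub : image (sideColor a b) {e ∈ faces n 1 | Within e L}
      ⊆ (stars L).biUnion fun i => (range (f i + 1) ×ˢ range (l - f i)).image
        (fun u => (((#{j ∈ ones L | j < i} + u.1 : ℕ) : ZMod a),
          ((#{j ∈ ones L | i < j} + u.2 : ℕ) : ZMod b))) := by
    intro c hc
    obtain ⟨e, he, rfl⟩ := mem_image.1 hc
    obtain ⟨he, hw⟩ := mem_filter.1 he
    obtain ⟨i, hi⟩ := card_eq_one.1 (mem_faces.1 he)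
    have hiL : i ∈ stars L := hw.stars_subset (hi ▸ mem_singleton_self i)
    have hg := card_lt_add_card_gt hiL
    obtain ⟨u, hu, h⟩ := exists_card_filter_ones_eq hw (fun j => j < i)
    obtain ⟨v, hv, h'⟩ := exists_card_filter_ones_eq hw (fun j => i < j)
    have hu := hu.trans (card_le_card (filter_subset_filter _ sdiff_subset))
    have hv := hv.trans (card_le_card (filter_subset_filter _ sdiff_subset))
    refine mem_biUnion.2 ⟨i, hiL, mem_image.2 ⟨(u, v), ?_, ?_⟩⟩
    · simp only [mem_product, mem_range, f]
      omega
    · simp only [sideColor, hi, mem_singleton, forall_eq, h, h']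
  refine (card_le_card hsub).trans (card_biUnion_le.trans ?_)
  have hle : ∀ i ∈ stars L, #((range (f i + 1) ×ˢ range (l - f i)).image
        (fun u => (((#{j ∈ ones L | j < i} + u.1 : ℕ) : ZMod a),
          ((#{j ∈ ones L | i < j} + u.2 : ℕ) : ZMod b)))) ≤ (f i + 1) * (l - f i) := by
    intro i _
    refine card_image_le.trans ?_
    rw [card_product, card_range, card_range]
  refine (sum_le_sum hle).trans ?_
  rw [← sum_succ_mul_sub, ← hl, ← (image_rank (stars L)).1, sum_image (image_rank (stars L)).2]

end Pattern

/-! ### Copies inside a subgraph -/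

namespace SimpleGraph

variable {V W : Type*} {G : SimpleGraph V}

/-- A subgraph of a subgraph, seen as a graph, does not depend on the ambient graph. -/
noncomputable def Subgraph.coeCoeSubgraphIso {G' : G.Subgraph} (S : G'.coe.Subgraph) :
    S.coe ≃g (Subgraph.coeSubgraph S).coe where
  toEquiv := Equiv.Set.image Subtype.val S.verts Subtype.val_injective
  map_rel_iff' := by
    rintro ⟨⟨a, ha⟩, ha'⟩ ⟨⟨b, hb⟩, hb'⟩
    change (Subgraph.coeSubgraph S).Adj a b ↔ S.Adj ⟨a, ha⟩ ⟨b, hb⟩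
    rw [Subgraph.coeSubgraph_adj]
    exact ⟨fun ⟨_, _, h⟩ => h, fun h => ⟨ha, hb, h⟩⟩

open Classical in
/-- Copies in a subgraph are the copies in the ambient graph that lie below it. -/
lemma copyCount_coe [Fintype V] (G' : G.Subgraph) [Fintype G'.verts] (T : SimpleGraph W) :
    G'.coe.copyCount T
      = (Finset.univ.filter fun S : G.Subgraph => Nonempty (T ≃g S.coe) ∧ S ≤ G').card := by
  rw [copyCount]
  refine Finset.card_nbij' Subgraph.coeSubgraph Subgraph.restrict ?_ ?_ ?_ ?_
  · intro S hS
    simp only [Finset.coe_filter, Finset.mem_univ, true_and, Set.mem_ofPred_eq] at hS ⊢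
    obtain ⟨f⟩ := hS
    exact ⟨⟨f.trans (Subgraph.coeCoeSubgraphIso S)⟩, Subgraph.coeSubgraph_le S⟩
  · intro S hS
    simp only [Finset.coe_filter, Finset.mem_univ, true_and, Set.mem_ofPred_eq] at hS ⊢
    obtain ⟨⟨f⟩, hle⟩ := hS
    have h : Subgraph.coeSubgraph (G'.restrict S) = S := by
      rw [Subgraph.coeSubgraph_restrict_eq, inf_eq_right.2 hle]
    have e := (Subgraph.coeCoeSubgraphIso (G'.restrict S)).symm
    rw [h] at e
    exact ⟨f.trans e⟩
  · intro S _
    exact Subgraph.restrict_coeSubgraph S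
  · intro S hS
    simp only [Finset.coe_filter, Finset.mem_univ, true_and, Set.mem_ofPred_eq] at hS
    rw [Subgraph.coeSubgraph_restrict_eq, inf_eq_right.2 hS.2]

end SimpleGraph

/-! ### Faces as subcubes of the graph -/

namespace Pattern

open Finset

variable {n : ℕ}

/-- The subcube on a face. -/
def subcube (p : Pattern n) : (hypercube n).Subgraph :=
  (⊤ : (hypercube n).Subgraph).induce {x | ∀ i, p i = none ∨ p i = some (x i)}

lemma subcube_adj {p : Pattern n} {x y : Fin n → Bool} :
    (subcube p).Adj x y ↔
      x ∈ (subcube p).verts ∧ y ∈ (subcube p).verts ∧ (hypercube n).Adj x y := by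
  simp [subcube]

/-- The point of a face with value `b` at all free coordinates. -/
def point (p : Pattern n) (b : Bool) : Fin n → Bool := fun i => (p i).getD b

lemma point_mem (p : Pattern n) (b : Bool) : point p b ∈ (subcube p).verts := by
  intro i
  rcases h : p i with _ | c <;> simp [point, h]

/-- The two points differ exactly in the free coordinates of `q`, so a face through both must leave
those free. -/
lemma within_of_point_mem {q p : Pattern n} (h0 : point q false ∈ (subcube p).verts)
    (h1 : point q true ∈ (subcube p).verts) : Within q p := by
  intro i
  rcases h0 i with h | h
  · exact Or.inl h
  rcases h1 i with h' | h'
  · exact Or.inl h'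
  rcases hq : q i with _ | c
  · simp only [point, hq, Option.getD_none] at h h'
    rw [h] at h'; simp at h'
  · right
    simp only [point, hq, Option.getD_some] at h
    exact h.symm

lemma Within.verts_subset {q p : Pattern n} (h : Within q p) :
    (subcube q).verts ⊆ (subcube p).verts := by
  intro x hx i
  rcases h i with h | h
  · exact Or.inl h
  · rcases hx i with h' | h'
    · exact Or.inl (by rw [← h, h'])
    · exact Or.inr (by rw [← h, h'])

lemma subcube_le_subcube {q p : Pattern n} : subcube q ≤ subcube p ↔ Within q p := by
  refine ⟨fun h => within_of_point_mem (h.1 (point_mem q _)) (h.1 (point_mem q _)), fun h => ?_⟩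
  refine ⟨h.verts_subset, fun x y hxy => ?_⟩
  rw [subcube_adj] at hxy ⊢
  exact ⟨h.verts_subset hxy.1, h.verts_subset hxy.2.1, hxy.2.2⟩

lemma subcube_injective : Function.Injective (subcube (n := n)) := by
  intro p q h
  have h1 := subcube_le_subcube.1 h.le
  have h2 := subcube_le_subcube.1 h.ge
  funext i
  rcases h1 i with h | h
  · rcases h2 i with h' | h'
    · rw [h, h']
    · exact h'.symm
  · exact h

/-- The smallest face containing two points. -/
def join (x y : Fin n → Bool) : Pattern n := fun i => if x i = y i then some (x i) else none

lemma join_comm (x y : Fin n → Bool) : join x y = join y x := by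
  funext i
  by_cases h : x i = y i
  · simp [join, h]
  · simp [join, h, Ne.symm h]

lemma left_mem_join (x y : Fin n → Bool) : x ∈ (subcube (join x y)).verts := by
  intro i
  by_cases h : x i = y i <;> simp [join, h]

lemma right_mem_join (x y : Fin n → Bool) : y ∈ (subcube (join x y)).verts :=
  join_comm x y ▸ left_mem_join y x

lemma card_stars_join (x y : Fin n → Bool) : #(stars (join x y)) = hammingDist x y := by
  rw [hammingDist]
  congr 1
  ext i
  simp [join]

lemma join_within {x y : Fin n → Bool} {p : Pattern n} (hx : x ∈ (subcube p).verts)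
    (hy : y ∈ (subcube p).verts) : Within (join x y) p := by
  intro i
  rcases hx i with h | h
  · exact Or.inl h
  rcases hy i with h' | h'
  · exact Or.inl h'
  · right
    have : x i = y i := Option.some.inj (h.symm.trans h')
    simp [join, this, h']

lemma join_mem_faces {x y : Fin n → Bool} (h : (hypercube n).Adj x y) :
    join x y ∈ faces n 1 := by
  rw [mem_faces, card_stars_join]
  exact h

lemma join_point (p : Pattern n) : join (point p false) (point p true) = p := by
  funext i
  rcases h : p i with _ | c <;> simp [join, point, h]

lemma point_adj {e : Pattern n} (he : e ∈ faces n 1) :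
    (hypercube n).Adj (point e false) (point e true) := by
  change hammingDist _ _ = 1
  rw [← card_stars_join, join_point, ← mem_faces]
  exact he

/-- A subcube of positive dimension is the union of its edges. -/
lemma subcube_le_iff {m : ℕ} (hm : 1 ≤ m) {p : Pattern n} (hp : p ∈ faces n m)
    {G : (hypercube n).Subgraph} :
    subcube p ≤ G ↔ ∀ e ∈ faces n 1, Within e p → subcube e ≤ G := by
  refine ⟨fun h e _ hw => (subcube_le_subcube.2 hw).trans h, fun h => ?_⟩
  have hadj : ∀ x y, (subcube p).Adj x y → G.Adj x y := by
    intro x y hxy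
    obtain ⟨hx, hy, hxy⟩ := subcube_adj.1 hxy
    exact (h _ (join_mem_faces hxy) (join_within hx hy)).2
      (subcube_adj.2 ⟨left_mem_join x y, right_mem_join x y, hxy⟩)
  refine ⟨fun x hx => ?_, hadj⟩
  obtain ⟨i, hi⟩ : (stars p).Nonempty := card_pos.1 (by rw [mem_faces.1 hp]; omega)
  rw [mem_stars] at hi
  -- Positive dimension enters here: each vertex of the subcube is an end of one of its edges, hence
  -- lies in `G`.
  refine G.edge_vert (hadj x (Function.update x i (!x i)) (subcube_adj.2 ⟨hx, fun j => ?_, ?_⟩))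
  · by_cases hj : j = i
    · exact Or.inl (hj ▸ hi)
    · simpa [hj] using hx j
  · change hammingDist _ _ = 1
    rw [hammingDist, card_eq_one]
    refine ⟨i, ?_⟩
    ext j
    by_cases hj : j = i
    · subst hj; simp
    · simp [hj]

/-! ### Copies of cubes in cubes -/

/-- The standard embedding of a cube with prescribed directions `σ` and base point `b`. -/
def cubeMap {l : ℕ} (σ : Fin l → Fin n) (b : Fin n → Bool) (x : Fin l → Bool) : Fin n → Bool :=
  fun j => xor (b j) (decide (∃ i, σ i = j ∧ x i = true))

lemma cubeMap_apply {l : ℕ} {σ : Fin l → Fin n} (hσ : Function.Injective σ) (b : Fin n → Bool)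
    (x : Fin l → Bool) (i : Fin l) : cubeMap σ b x (σ i) = xor (b (σ i)) (x i) := by
  have : (∃ i', σ i' = σ i ∧ x i' = true) ↔ x i = true :=
    ⟨fun ⟨i', h, h'⟩ => hσ h ▸ h', fun h => ⟨i, rfl, h⟩⟩
  simp [cubeMap, this]

lemma cubeMap_apply_of_notMem {l : ℕ} {σ : Fin l → Fin n} (b : Fin n → Bool)
    (x : Fin l → Bool) {j : Fin n} (hj : j ∉ univ.image σ) : cubeMap σ b x j = b j := by
  have : ¬ ∃ i, σ i = j ∧ x i = true := by
    rintro ⟨i, rfl, -⟩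
    exact hj (mem_image_of_mem _ (mem_univ i))
  simp [cubeMap, this]

lemma hammingDist_cubeMap {l : ℕ} {σ : Fin l → Fin n} (hσ : Function.Injective σ)
    (b : Fin n → Bool) (x y : Fin l → Bool) :
    hammingDist (cubeMap σ b x) (cubeMap σ b y) = hammingDist x y := by
  rw [hammingDist, hammingDist, ← card_image_of_injective _ hσ]
  congr 1
  ext j
  by_cases hj : j ∈ univ.image σ
  · obtain ⟨i, -, rfl⟩ := mem_image.1 hj
    simp [cubeMap_apply hσ, hσ.eq_iff]
  · have h : ∀ i, σ i ≠ j := fun i h => hj (h ▸ mem_image_of_mem _ (mem_univ i))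
    simp [cubeMap_apply_of_notMem _ _ hj, h]

lemma range_cubeMap {l : ℕ} {σ : Fin l → Fin n} (hσ : Function.Injective σ)
    {b : Fin n → Bool} {p : Pattern n} (hs : stars p = univ.image σ)
    (hb : b ∈ (subcube p).verts) : Set.range (cubeMap σ b) = (subcube p).verts := by
  ext y
  constructor
  · rintro ⟨x, rfl⟩ j
    by_cases hj : j ∈ univ.image σ
    · exact Or.inl (mem_stars.1 (hs ▸ hj))
    · rw [cubeMap_apply_of_notMem _ _ hj]
      exact hb j
  · intro hy
    refine ⟨fun i => xor (b (σ i)) (y (σ i)), funext fun j => ?_⟩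
    by_cases hj : j ∈ univ.image σ
    · obtain ⟨i, -, rfl⟩ := mem_image.1 hj
      simp [cubeMap_apply hσ]
    · rw [cubeMap_apply_of_notMem _ _ hj]
      rw [← hs, mem_stars] at hj
      exact Option.some.inj (((hb j).resolve_left hj).symm.trans ((hy j).resolve_left hj))

lemma hypercube_adj {m : ℕ} {x y : Fin m → Bool} :
    (hypercube m).Adj x y ↔ hammingDist x y = 1 := Iff.rfl

lemma nonempty_iso_subcube {l : ℕ} {p : Pattern n} (hp : p ∈ faces n l) :
    Nonempty (hypercube l ≃g (subcube p).coe) := by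
  have hσ := ((stars p).orderEmbOfFin (mem_faces.1 hp)).injective
  set σ := (stars p).orderEmbOfFin (mem_faces.1 hp)
  have hr := range_cubeMap hσ (image_orderEmbOfFin_univ _ _).symm (point_mem p false)
  have hinj : Function.Injective (cubeMap σ (point p false)) := fun x y h => by
    rw [← hammingDist_eq_zero, ← hammingDist_cubeMap hσ (point p false), h, hammingDist_self]
  refine ⟨⟨(Equiv.ofInjective _ hinj).trans (Equiv.setCongr hr), fun {x y} => ?_⟩⟩
  have hm : ∀ x, cubeMap σ (point p false) x ∈ (subcube p).verts := fun x => hr ▸ ⟨x, rfl⟩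
  simp only [Equiv.trans_apply, SimpleGraph.Subgraph.coe_adj, Equiv.setCongr_apply,
    Equiv.ofInjective_apply, subcube_adj, hm, true_and, hypercube_adj, hammingDist_cubeMap hσ]

/-- Flip one coordinate. -/
def flip {m : ℕ} (x : Fin m → Bool) (i : Fin m) : Fin m → Bool := Function.update x i (!x i)

lemma flip_apply {m : ℕ} (x : Fin m → Bool) (i j : Fin m) :
    flip x i j = xor (x j) (decide (j = i)) := by
  by_cases h : j = i
  · subst h; simp [flip]
  · simp [flip, h]

lemma adj_flip {m : ℕ} (x : Fin m → Bool) (i : Fin m) : (hypercube m).Adj x (flip x i) := by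
  rw [hypercube_adj, hammingDist, card_eq_one]
  refine ⟨i, ?_⟩
  ext j
  cases h : x j <;> simp [flip_apply, h]

lemma exists_flip_of_adj {m : ℕ} {x y : Fin m → Bool} (h : (hypercube m).Adj x y) :
    ∃ i, y = flip x i := by
  rw [hypercube_adj, hammingDist, card_eq_one] at h
  obtain ⟨i, hi⟩ := h
  refine ⟨i, funext fun j => ?_⟩
  have : x j ≠ y j ↔ j = i := by simpa using Finset.ext_iff.1 hi j
  rw [flip_apply]
  by_cases hj : j = i
  · have := this.2 hj
    cases hx : x j <;> cases hy : y j <;> simp_all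
  · have : x j = y j := by_contra fun h => hj (this.1 h)
    simp [this, hj]

lemma flip_induction {m : ℕ} {P : (Fin m → Bool) → Prop} (h0 : P fun _ => false)
    (hstep : ∀ x i, x i = false → P x → P (flip x i)) (x : Fin m → Bool) : P x := by
  suffices h : ∀ s : Finset (Fin m), P fun i => decide (i ∈ s) by
    have := h {i | x i = true}
    simpa using this
  intro s
  induction s using Finset.induction_on with
  | empty => simpa using h0
  | insert a s ha ih =>
    convert hstep _ a (by simpa using ha) ih using 1
    funext j
    rw [flip_apply]
    by_cases h : j = a
    · subst h; simp [ha]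
    · simp [h]

/-- An injective homomorphism between cubes is a standard embedding: opposite edges of a
4-cycle are mapped to parallel edges. -/
lemma exists_eq_cubeMap {l : ℕ} {g : (Fin l → Bool) → (Fin n → Bool)}
    (hg : Function.Injective g)
    (hadj : ∀ x y, (hypercube l).Adj x y → (hypercube n).Adj (g x) (g y)) :
    ∃ (σ : Fin l → Fin n) (b : Fin n → Bool), Function.Injective σ ∧ g = cubeMap σ b := by
  choose τ hτ using fun x i => exists_flip_of_adj (hadj x _ (adj_flip x i))
  have hne : ∀ x i j, i ≠ j → τ x i ≠ τ x j := by
    intro x i j hij h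
    have h1 : g (flip x i) = g (flip x j) := by rw [hτ, hτ, h]
    have h2 := congrFun (hg h1) i
    simp [flip_apply, hij] at h2
  -- Compare the two paths around a 4-cycle. By injectivity the first path flips coordinate `τ x i`
  -- exactly once, so the second must flip it as well; its first step does not, so its second step
  -- does.
  have hpar : ∀ x i j, i ≠ j → τ (flip x j) i = τ x i := by
    intro x i j hij
    have hcomm : flip (flip x i) j = flip (flip x j) i := by
      funext t
      simp only [flip_apply]
      rw [Bool.xor_assoc, Bool.xor_assoc, Bool.xor_comm (decide (t = i))]
    have h1 : g (flip (flip x i) j) = g (flip (flip x j) i) := by rw [hcomm]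
    have h2 : τ (flip x i) j ≠ τ x i := by
      intro h
      have h3 : g (flip (flip x i) j) = g x := by
        rw [hτ, hτ, h]
        funext t
        simp [flip_apply]
      have h4 := congrFun (hg h3) i
      simp [flip_apply, hij] at h4
    rw [hτ, hτ x i, hτ, hτ x j] at h1
    have h3 := congrFun h1 (τ x i)
    simp only [flip_apply, hne x i j hij, h2.symm, decide_true, decide_false, Bool.xor_false] at h3
    by_contra h
    simp [Ne.symm h] at h3
  have hpar' : ∀ x i j, τ (flip x j) i = τ x i := by
    intro x i j
    by_cases hij : i = j
    · subst hij
      have h1 : flip (flip x i) i = x := by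
        funext t; simp [flip_apply]
      have h2 := hτ (flip x i) i
      rw [h1, hτ x i] at h2
      have h3 := congrFun h2 (τ x i)
      simp only [flip_apply, decide_true] at h3
      by_contra h
      simp [Ne.symm h] at h3
    · exact hpar x i j hij
  refine ⟨τ fun _ => false, g fun _ => false, fun i j h => by_contra fun hij => hne _ i j hij h, ?_⟩
  have hinj : Function.Injective (τ fun _ => false) :=
    fun i j h => by_contra fun hij => hne _ i j hij h
  funext x
  suffices h : g x = cubeMap (τ fun _ => false) (g fun _ => false) x ∧
      ∀ i, τ x i = τ (fun _ => false) i from h.1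
  induction x using flip_induction with
  | h0 =>
    refine ⟨?_, fun _ => rfl⟩
    funext j
    simp [cubeMap]
  | hstep x i hx ih =>
    refine ⟨?_, fun j => by rw [hpar', ih.2]⟩
    rw [hτ, ih.1, ih.2]
    funext j
    rw [flip_apply]
    by_cases hj : j ∈ univ.image (τ fun _ => false)
    · obtain ⟨t, -, rfl⟩ := mem_image.1 hj
      rw [cubeMap_apply hinj, cubeMap_apply hinj, flip_apply, Bool.xor_assoc]
      simp [hinj.eq_iff]
    · have : j ≠ τ (fun _ => false) i := fun h => hj (h ▸ mem_image_of_mem _ (mem_univ i))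
      rw [cubeMap_apply_of_notMem _ _ hj, cubeMap_apply_of_notMem _ _ hj]
      simp [this]

/-- The copies of `Q_l` in `Q_n` are the subcubes. -/
lemma nonempty_iso_iff {l : ℕ} {S : (hypercube n).Subgraph} :
    Nonempty (hypercube l ≃g S.coe) ↔ ∃ p ∈ faces n l, subcube p = S := by
  constructor
  · rintro ⟨f⟩
    have hSadj : ∀ x y, S.Adj (f x) (f y) ↔ (hypercube l).Adj x y := fun x y => by
      rw [← SimpleGraph.Subgraph.coe_adj, f.map_adj_iff]
    obtain ⟨σ, b, hσ, hg⟩ := exists_eq_cubeMap (g := fun x => (f x : Fin n → Bool))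
      (fun x y h => f.injective (Subtype.ext h)) (fun x y h => ((hSadj x y).2 h).adj_sub)
    set p : Pattern n := fun j => if j ∈ univ.image σ then none else some (b j) with hp
    have hs : stars p = univ.image σ := by
      ext j; simp [hp]
    have hb : b ∈ (subcube p).verts := by
      intro j
      by_cases hj : j ∈ univ.image σ
      · exact Or.inl (if_pos hj)
      · exact Or.inr (if_neg hj)
    have hr := range_cubeMap hσ hs hb
    have hverts : ∀ y, y ∈ S.verts → ∃ x, cubeMap σ b x = y := fun y hy => by
      obtain ⟨x, hx⟩ := f.surjective ⟨y, hy⟩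
      exact ⟨x, by rw [← hg]; exact congrArg Subtype.val hx⟩
    have hfx : ∀ x, (f x : Fin n → Bool) = cubeMap σ b x := fun x => congrFun hg x
    -- Since `cubeMap` preserves Hamming distance, the copy is an induced subgraph and is determined
    -- by its vertices.
    have hadj : ∀ x y, S.Adj (cubeMap σ b x) (cubeMap σ b y) ↔
        (hypercube n).Adj (cubeMap σ b x) (cubeMap σ b y) := fun x y => by
      rw [← hfx, ← hfx, hSadj, hfx, hfx, hypercube_adj, hypercube_adj, hammingDist_cubeMap hσ]
    refine ⟨p, ?_, ?_⟩
    · rw [mem_faces, hs, card_image_of_injective _ hσ, card_univ, Fintype.card_fin]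
    · have hv : (subcube p).verts = S.verts := by
        rw [← hr]
        ext y
        refine ⟨?_, hverts y⟩
        rintro ⟨x, rfl⟩
        rw [← hfx]
        exact (f x).2
      refine SimpleGraph.Subgraph.ext hv ?_
      funext x y
      refine propext ⟨fun h => ?_, fun h => ?_⟩
      · obtain ⟨hx, hy, h⟩ := subcube_adj.1 h
        rw [← hr] at hx hy
        obtain ⟨x, rfl⟩ := hx
        obtain ⟨y, rfl⟩ := hy
        exact (hadj x y).2 h
      · exact subcube_adj.2 ⟨hv ▸ S.edge_vert h, hv ▸ S.edge_vert h.symm, h.adj_sub⟩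
  · rintro ⟨p, hp, rfl⟩
    exact nonempty_iso_subcube hp

lemma copyCount_hypercube (n l : ℕ) : (hypercube n).copyCount (hypercube l) = #(faces n l) := by
  classical
  rw [SimpleGraph.copyCount, ← card_image_of_injective _ subcube_injective]
  congr 1
  ext S
  simp only [mem_filter, mem_univ, true_and, mem_image, nonempty_iso_iff]

/-! ### Subgraphs and their missing edges -/

/-- The edges of the cube, as faces, that are missing from a subgraph. -/
noncomputable def missing (G : (hypercube n).Subgraph) : Finset (Pattern n) := by
  classical exact {e ∈ faces n 1 | ¬ subcube e ≤ G}

lemma missing_subset (G : (hypercube n).Subgraph) : missing G ⊆ faces n 1 := by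
  classical exact filter_subset _ _

lemma mem_missing {G : (hypercube n).Subgraph} {e : Pattern n} :
    e ∈ missing G ↔ e ∈ faces n 1 ∧ ¬ subcube e ≤ G := by
  classical
  simp only [missing, mem_filter]

lemma subcube_le_iff_notMem_hit {l : ℕ} (hl : 1 ≤ l) {p : Pattern n} (hp : p ∈ faces n l)
    {G : (hypercube n).Subgraph} : subcube p ≤ G ↔ p ∉ hit (missing G) l := by
  rw [subcube_le_iff hl hp]
  simp only [hit, mem_filter, hp, true_and, mem_missing, not_exists, not_and]
  exact ⟨fun h e he hw => he.2 (h e he.1 hw), fun h e he hw => by_contra fun hn => h e ⟨he, hn⟩ hw⟩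

lemma copyCount_coe_add_card_hit {l : ℕ} (hl : 1 ≤ l) (G : (hypercube n).Subgraph)
    [Fintype G.verts] :
    G.coe.copyCount (hypercube l) + #(hit (missing G) l) = #(faces n l) := by
  classical
  have : G.coe.copyCount (hypercube l) = #(faces n l \ hit (missing G) l) := by
    rw [SimpleGraph.copyCount_coe, ← card_image_of_injective _ subcube_injective]
    congr 1
    ext S
    simp only [mem_filter, mem_univ, true_and, mem_image, nonempty_iso_iff, mem_sdiff]
    constructor
    · rintro ⟨⟨p, hp, rfl⟩, hle⟩
      exact ⟨p, ⟨hp, (subcube_le_iff_notMem_hit hl hp).1 hle⟩, rfl⟩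
    · rintro ⟨p, ⟨hp, hn⟩, rfl⟩
      exact ⟨⟨p, hp, rfl⟩, (subcube_le_iff_notMem_hit hl hp).2 hn⟩
  rw [this, card_sdiff_add_card_eq_card (hit_subset _ _)]

lemma free_iff {k : ℕ} (hk : 1 ≤ k) (G : (hypercube n).Subgraph) :
    (hypercube k).Free G.coe ↔ faces n k ⊆ hit (missing G) k := by
  classical
  have h := copyCount_coe_add_card_hit hk G
  rw [← SimpleGraph.copyCount_eq_zero]
  constructor
  · intro h0
    exact (eq_of_subset_of_card_le (hit_subset _ _) (by omega)).ge
  · intro hs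
    have := card_le_card hs
    omega

/-- The spanning subgraph of the cube obtained by deleting a set of edges. -/
def deleteFaces (E : Finset (Pattern n)) : (hypercube n).Subgraph where
  verts := Set.univ
  Adj x y := (hypercube n).Adj x y ∧ join x y ∉ E
  adj_sub h := h.1
  edge_vert _ := trivial
  symm := ⟨fun x y h => ⟨h.1.symm, join_comm x y ▸ h.2⟩⟩

lemma missing_deleteFaces {E : Finset (Pattern n)} (hE : E ⊆ faces n 1) :
    missing (deleteFaces E) = E := by
  ext e
  rw [mem_missing]
  constructor
  · rintro ⟨he, h⟩
    by_contra hn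
    refine h ⟨fun _ _ => trivial, fun x y hxy => ?_⟩
    obtain ⟨hx, hy, hxy⟩ := subcube_adj.1 hxy
    refine ⟨hxy, ?_⟩
    have hw := join_within hx hy
    have hst : stars (join x y) = stars e :=
      eq_of_subset_of_card_le hw.stars_subset
        (by rw [mem_faces.1 he, mem_faces.1 (join_mem_faces hxy)])
    have : join x y = e := by
      funext i
      rcases hw i with h | h
      · rw [h, ← mem_stars, hst, mem_stars, h]
      · exact h
    rwa [this]
  · intro he
    refine ⟨hE he, fun h => ?_⟩
    have := h.2 (subcube_adj.2 ⟨point_mem e false, point_mem e true, point_adj (hE he)⟩)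
    exact this.2 (by rwa [join_point])

/-! ### The extremal number in terms of hitting sets of edges -/

lemma card_faces_pos {n l : ℕ} (h : l ≤ n) : 0 < #(faces n l) := by
  rw [card_faces]
  have := Nat.choose_pos h
  positivity

lemma le_genExtremal {V W U : Type*} [Fintype V] {G : SimpleGraph V} (T : SimpleGraph W)
    {H : SimpleGraph U} {G' : G.Subgraph} [Fintype G'.verts] (h : H.Free G'.coe) :
    G'.coe.copyCount T ≤ genExtremal G T H := by
  classical
  unfold genExtremal
  refine le_trans (Eq.le ?_) (le_sup (mem_filter.2 ⟨mem_univ G', h⟩))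
  congr!

lemma genExtremal_le {V W U : Type*} [Fintype V] {G : SimpleGraph V} {T : SimpleGraph W}
    {H : SimpleGraph U} {N : ℕ}
    (h : ∀ (G' : G.Subgraph) [Fintype G'.verts], H.Free G'.coe → G'.coe.copyCount T ≤ N) :
    genExtremal G T H ≤ N := by
  classical
  exact Finset.sup_le fun G' hG' => h G' (mem_filter.1 hG').2

lemma le_genTuranDensity {k l : ℕ} (hk : 1 ≤ k) (hl : 1 ≤ l) (hln : l ≤ n)
    {E : Finset (Pattern n)} (hE : E ⊆ faces n 1) (h : faces n k ⊆ hit E k) :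
    1 - (#(hit E l) : ℝ) / #(faces n l)
      ≤ genTuranDensity (hypercube n) (hypercube l) (hypercube k) := by
  classical
  have hfree : (hypercube k).Free (deleteFaces E).coe := by
    rw [free_iff hk, missing_deleteFaces hE]
    exact h
  have hle : (deleteFaces E).coe.copyCount (hypercube l)
      ≤ genExtremal (hypercube n) (hypercube l) (hypercube k) := by
    exact le_genExtremal _ hfree
  have hadd := copyCount_coe_add_card_hit hl (deleteFaces E)
  rw [missing_deleteFaces hE] at hadd
  have hpos : (0 : ℝ) < #(faces n l) := by exact_mod_cast card_faces_pos hln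
  rw [genTuranDensity, copyCount_hypercube, one_sub_div hpos.ne']
  gcongr
  rw [sub_le_iff_le_add]
  exact_mod_cast (by omega)

lemma genTuranDensity_le {k l : ℕ} (hk : 1 ≤ k) (hl : 1 ≤ l) (hln : l ≤ n) {δ : ℝ}
    (hδ : δ ≤ 1)
    (h : ∀ E ⊆ faces n 1, faces n k ⊆ hit E k → δ * #(faces n l) ≤ #(hit E l)) :
    genTuranDensity (hypercube n) (hypercube l) (hypercube k) ≤ 1 - δ := by
  classical
  have hpos : (0 : ℝ) < #(faces n l) := by exact_mod_cast card_faces_pos hln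
  rw [genTuranDensity, copyCount_hypercube, div_le_iff₀ hpos]
  -- The extremal number is a supremum of naturals, so the real bound is rounded down; `δ ≤ 1` makes
  -- it nonnegative.
  suffices hs : genExtremal (hypercube n) (hypercube l) (hypercube k)
      ≤ ⌊(1 - δ) * #(faces n l)⌋₊ from
    (Nat.cast_le.2 hs).trans (Nat.floor_le (mul_nonneg (by linarith) hpos.le))
  refine genExtremal_le fun G _ hG => Nat.le_floor ?_
  have hfree := (free_iff hk G).1 hG
  have h1 := h _ (missing_subset G) hfree
  have h2 : (G.coe.copyCount (hypercube l) : ℝ) + #(hit (missing G) l) = #(faces n l) := by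
    exact_mod_cast copyCount_coe_add_card_hit hl G
  linarith

/-! ### The four bounds -/

lemma one_sub_div_le_genTuranDensity {k l : ℕ} (hl : 1 ≤ l) (hlk : l ≤ k) (hkn : k ≤ n) :
    1 - (l : ℝ) / k ≤ genTuranDensity (hypercube n) (hypercube l) (hypercube k) := by
  have : NeZero k := ⟨by omega⟩
  obtain ⟨c, hc⟩ := exists_color_card_hit_le (levelColor (n := n) k)
    (fun L hL => card_image_levelColor_le k (l := l) hL)
  rw [ZMod.card] at hc
  refine le_trans ?_ (le_genTuranDensity (by omega) hl (by omega) (filter_subset _ _)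
    (faces_subset_hit_levelColor c))
  have hpos : (0 : ℝ) < #(faces n l) := by exact_mod_cast card_faces_pos (hlk.trans hkn)
  have hk : (0 : ℝ) < k := by exact_mod_cast (by omega : 0 < k)
  refine sub_le_sub_left ?_ 1
  rw [div_le_div_iff₀ hpos hk]
  exact_mod_cast hc

lemma one_sub_choose_div_le_genTuranDensity {k l : ℕ} (hl : 1 ≤ l) (hlk : l ≤ k) (hkn : k ≤ n) :
    1 - 4 * ((l + 2).choose 3 : ℝ) / (k * (k + 2))
      ≤ genTuranDensity (hypercube n) (hypercube l) (hypercube k) := by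
  -- Split `k + 1` as evenly as possible to maximise the number of colours `a * b`; for even `k` the
  -- product inequality is an equality.
  obtain ⟨a, b, ha, hb, hab, hprod⟩ :
      ∃ a b : ℕ, 0 < a ∧ 0 < b ∧ a + b = k + 1 ∧ k * (k + 2) ≤ 4 * (a * b) := by
    rcases Nat.even_or_odd' k with ⟨m, rfl | rfl⟩
    · exact ⟨m, m + 1, by omega, by omega, by omega, by nlinarith⟩
    · exact ⟨m + 1, m + 1, by omega, by omega, by omega, by nlinarith⟩
  have : NeZero a := ⟨ha.ne'⟩
  have : NeZero b := ⟨hb.ne'⟩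
  obtain ⟨c, hc⟩ := exists_color_card_hit_le (sideColor (n := n) a b)
    (fun L hL => card_image_sideColor_le a b (l := l) hL)
  rw [Fintype.card_prod, ZMod.card, ZMod.card] at hc
  refine le_trans ?_ (le_genTuranDensity (by omega) hl (by omega) (filter_subset _ _)
    (faces_subset_hit_sideColor hab c))
  have hpos : (0 : ℝ) < #(faces n l) := by exact_mod_cast card_faces_pos (hlk.trans hkn)
  have hk : (0 : ℝ) < k := by exact_mod_cast (by omega : 0 < k)
  refine sub_le_sub_left ?_ 1
  rw [div_le_div_iff₀ hpos (by positivity)]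
  have hc' := (Nat.mul_le_mul_left #(hit {e ∈ faces n 1 | sideColor a b e = c} l) hprod).trans
    ((Nat.mul_left_comm _ _ _).trans_le (Nat.mul_le_mul_left 4 hc))
  rw [mul_assoc (4 : ℝ)]
  exact_mod_cast hc'

lemma genTuranDensity_le_one_sub {k l : ℕ} (hl : 1 ≤ l) (hlk : l ≤ k) (hkn : k ≤ n) :
    genTuranDensity (hypercube n) (hypercube l) (hypercube k)
      ≤ 1 - (l : ℝ) * 2 ^ l / (k * 2 ^ k) := by
  have hk : (0 : ℝ) < k := by exact_mod_cast (by omega : 0 < k)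
  refine genTuranDensity_le (by omega) hl (by omega) ?_ fun E hE h => ?_
  · rw [div_le_one (by positivity)]
    have : (l : ℝ) ≤ k := by exact_mod_cast hlk
    gcongr
    norm_num
  · have key := choose_mul_card_faces_le_card_hit hl hlk hkn hE h
    have hid := Nat.choose_mul (n := k) hl
    rw [Nat.choose_one_right, Nat.choose_one_right] at hid
    have hpos : 0 < (k - 1).choose (l - 1) := Nat.choose_pos (by omega)
    have h2 : 2 ^ k = 2 ^ (k - l) * 2 ^ l := by rw [← pow_add]; congr 1; omega
    have main : l * 2 ^ l * #(faces n l) ≤ #(hit E l) * (k * 2 ^ k) := by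
      refine Nat.le_of_mul_le_mul_right ?_ hpos
      calc _ = ((k - 1).choose (l - 1) * #(faces n l)) * (l * 2 ^ l) := by ring
        _ ≤ (#(hit E l) * (k.choose l * 2 ^ (k - l))) * (l * 2 ^ l) := by gcongr
        _ = #(hit E l) * (k.choose l * l) * (2 ^ (k - l) * 2 ^ l) := by ring
        _ = _ := by rw [hid, ← h2]; ring
    rw [div_mul_eq_mul_div, div_le_iff₀ (by positivity)]
    exact_mod_cast main

lemma genTuranDensity_le_one_sub_log {k l : ℕ} (hk : 2 ≤ k) (hl : 1 ≤ l) (hln : l ≤ n)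
    (hkn : k + 2 ≤ n) :
    genTuranDensity (hypercube n) (hypercube l) (hypercube k)
      ≤ 1 - 1 / 8 * Real.log k / (k * 2 ^ k) := by
  have hk0 : (2 : ℝ) ≤ k := by exact_mod_cast hk
  refine genTuranDensity_le (by omega) hl hln ?_ fun E hE h => ?_
  · have h1 := Real.log_le_self (x := (k : ℝ)) (by linarith)
    have h2 : (1 : ℝ) ≤ 2 ^ k := one_le_pow₀ (by norm_num)
    rw [div_le_one (by positivity)]
    nlinarith
  -- Here `s` is `log₃ (k + 2)` rounded up, the guaranteed number of edges of `E` in a `(k +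
  -- 2)`-face, which has `(k + 2) * 2 ^ (k + 1)` edges. The factor 2 is a crude bound for `log 3`.
  · obtain ⟨s, hs, hsE⟩ : ∃ s : ℕ, Real.log k ≤ 2 * s ∧
        s * #(faces n 1) ≤ #E * ((k + 2) * 2 ^ (k + 1)) := by
      refine ⟨Nat.clog 3 (k + 2), ?_, ?_⟩
      · have h1 : ((k + 2 : ℕ) : ℝ) ≤ 3 ^ Nat.clog 3 (k + 2) := by
          exact_mod_cast Nat.le_pow_clog (by norm_num) (k + 2)
        have h2 : Real.log k ≤ Real.log (3 ^ Nat.clog 3 (k + 2)) := by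
          refine Real.log_le_log (by linarith) (le_trans ?_ h1)
          push_cast
          linarith
        rw [Real.log_pow] at h2
        have h3 : Real.log 3 ≤ 2 := by
          have := Real.log_le_sub_one_of_pos (x := 3) (by norm_num)
          linarith
        have h4 : (0 : ℝ) ≤ Nat.clog 3 (k + 2) := Nat.cast_nonneg _
        nlinarith
      · have := mul_card_faces_le (l := 1) (m := k + 2) (by omega) hkn hE (fun M hM =>
          Nat.clog_le_of_le_pow (le_three_pow_of_hit h hM))
        rwa [Nat.choose_one_right] at this
    have hshadow := card_mul_card_faces_le_card_hit hl hln hE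
    have h1 : 0 < #(faces n 1) := card_faces_pos (by omega)
    have main : s * #(faces n l) ≤ #(hit E l) * ((k + 2) * 2 ^ (k + 1)) := by
      refine Nat.le_of_mul_le_mul_right ?_ h1
      calc s * #(faces n l) * #(faces n 1) = (s * #(faces n 1)) * #(faces n l) := by ring
        _ ≤ (#E * ((k + 2) * 2 ^ (k + 1))) * #(faces n l) := by gcongr
        _ = (#E * #(faces n l)) * ((k + 2) * 2 ^ (k + 1)) := by ring
        _ ≤ (#(hit E l) * #(faces n 1)) * ((k + 2) * 2 ^ (k + 1)) := by gcongr
        _ = _ := by ring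
    have main' : (s : ℝ) * #(faces n l) ≤ #(hit E l) * ((k + 2) * 2 ^ (k + 1)) := by
      exact_mod_cast main
    rw [div_mul_eq_mul_div, div_le_iff₀ (by positivity)]
    calc 1 / 8 * Real.log k * #(faces n l) ≤ 1 / 8 * (2 * s) * #(faces n l) := by gcongr
      _ = 1 / 4 * (s * #(faces n l)) := by ring
      _ ≤ 1 / 4 * (#(hit E l) * ((k + 2) * 2 ^ (k + 1))) := by gcongr
      _ = #(hit E l) * ((k + 2) / 2 * 2 ^ k) := by ring
      _ ≤ #(hit E l) * (k * 2 ^ k) := by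
        gcongr
        linarith

end Pattern

theorem theorem1 :
    ∃ α : ℝ, 0 < α ∧ ∀ k ℓ : ℕ, 2 ≤ ℓ → ℓ < k → ∃ n₀ : ℕ, ∀ n : ℕ, n₀ ≤ n →
      max (1 - (ℓ : ℝ) / (k : ℝ))
          (1 - 4 * ((ℓ + 2).choose 3 : ℝ) / ((k : ℝ) * ((k : ℝ) + 2)))
        ≤ genTuranDensity (hypercube n) (hypercube ℓ) (hypercube k) ∧
      genTuranDensity (hypercube n) (hypercube ℓ) (hypercube k)
        ≤ min (1 - (ℓ : ℝ) * 2 ^ ℓ / ((k : ℝ) * 2 ^ k))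
              (1 - α * Real.log (k : ℝ) / ((k : ℝ) * 2 ^ k)) := by
  -- The constant is `1/2` from `log 3 ≤ 2` times `1/4` from `(k + 2) * 2 ^ (k + 1) ≤ 4 * k * 2 ^
  -- k`. The threshold `k + 2` lets the logarithmic bound average over `(k + 2)`-faces.
  refine ⟨1 / 8, by norm_num, fun k ℓ hℓ hk => ⟨k + 2, fun n hn => ⟨max_le ?_ ?_, le_min ?_ ?_⟩⟩⟩
  · exact Pattern.one_sub_div_le_genTuranDensity (by omega) hk.le (by omega)
  · exact Pattern.one_sub_choose_div_le_genTuranDensity (by omega) hk.le (by omega)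
  · exact Pattern.genTuranDensity_le_one_sub (by omega) hk.le (by omega)
  · exact Pattern.genTuranDensity_le_one_sub_log (by omega) (by omega) (by omega) hn
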